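/- Let $\alpha>0$, $t>0$ and $w(x,t)=(1-x^2)^{\alpha}\,\mathrm{e}^{-t/(1-x^2)}$ for $x\in[-1,1]$. Let $P_n(x,t)$, $n=0,1,2,\dots$, be the monic polynomials with $\deg P_n=n$ that are orthogonal with respect to this weight, $\int_{-1}^{1}P_m(x,t)P_n(x,t)w(x,t)\,dx=0$ for $m\neq n$. Let $\mathrm{p}(n)=\mathrm{p}(n,t)$ be the coefficient of $x^{n-2}$ in $P_n(x,t)$ for $n\ge 2$, and $\mathrm{p}(0)=\mathrm{p}(1)=0$. **Theorem.** For every integer $n\ge 1$, the sub-leading coefficient satisfies the second-order nonlinear difference equation $$ \begin{aligned} &\left(n+2\mathrm{p}(n)-\tilde{\mathrm{p}}(n+1)\right)^3+\left(n+2\mathrm{p}(n)-\tilde{\mathrm{p}}(n+1)\right)^2\left(n-2+4t-\tilde{\mathrm{p}}(n-1)+\tilde{\mathrm{p}}(n+1)\right)\\ &-2\left(n+2\mathrm{p}(n)-\tilde{\mathrm{p}}(n+1)\right)\big[n^2-n(1-\alpha)-\alpha+2t-2t^2-\tilde{\mathrm{p}}(n-1)\left(n+\alpha-t-\tilde{\mathrm{p}}(n+1)\right)-(n-1+2t)\,\tilde{\mathrm{p}}(n+1)\big]\\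 &-\left(n-1+2t-\tilde{\mathrm{p}}(n-1)\right)\big[2nt-\tilde{\mathrm{p}}(n+1)\left(n-1+2t-\tilde{\mathrm{p}}(n-1)\right)\big]+4\,\mathrm{p}(n)^2\,\tilde{\mathrm{p}}(n+1)\\ &+2\mathrm{p}(n)\big[\left(n+2\mathrm{p}(n)-\tilde{\mathrm{p}}(n+1)\right)^2+2\tilde{\mathrm{p}}(n+1)\left(n-1+2t-\tilde{\mathrm{p}}(n-1)\right)\\ &\qquad-2\left(n+2\mathrm{p}(n)-\tilde{\mathrm{p}}(n+1)\right)\left(n+\alpha-t-\tilde{\mathrm{p}}(n+1)\right)-2nt\big]=0, \end{aligned} $$ where $$ \tilde{\mathrm{p}}(n-1):=(2n-3+2\alpha)\left(\mathrm{p}(n-1)-\mathrm{p}(n)\right),\qquad \tilde{\mathrm{p}}(n+1):=(2n+1+2\alpha)\left(\mathrm{p}(n)-\mathrm{p}(n+1)\right). $$ -/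

import Mathlib

open Polynomial

noncomputable section

namespace PollaczekJacobi

/-- The weight `w(x,t) = (1 - x²)^α exp(-t / (1 - x²))` on `[-1, 1]`. It is integrated over
`[-1, 1]` only; its value at the two end points is `0`. -/
def weight (α t x : ℝ) : ℝ :=
  (1 - x ^ 2) ^ α * Real.exp (-(t / (1 - x ^ 2)))

/-- The bilinear form `⟨p, q⟩ = ∫_{-1}^{1} p(x) q(x) w(x,t) dx` on real polynomials. -/
def form (α t : ℝ) (p q : ℝ[X]) : ℝ :=
  ∫ x in (-1 : ℝ)..1, p.eval x * q.eval x * weight α t x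

/-- The monic orthogonal polynomials `P_n(x,t)` of the weight, built from `1, x, x², …` by the
(non-normalizing) Gram-Schmidt process. That they are monic of degree `n` and orthogonal, and that
they are the only such polynomials, is proved in `P_monic`, `P_natDegree`, `form_P_P`, `form_P_self_pos`
and `P_unique`. -/
def P (α t : ℝ) (n : ℕ) : ℝ[X] :=
  X ^ n - ∑ k : Fin n,
    C (form α t (X ^ n) (P α t k) / form α t (P α t k) (P α t k)) * P α t k
termination_by n
decreasing_by exact k.2

/-- The sub-leading coefficient `p(n,t)`, the coefficient of `x^{n-2}` in `P_n(x,t)`, with the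
initial values `p(0,t) = p(1,t) = 0`. -/
def subleadingCoeff (α t : ℝ) (n : ℕ) : ℝ :=
  if 2 ≤ n then (P α t n).coeff (n - 2) else 0

/-! ### The polynomials `P_n` are the monic orthogonal polynomials of the weight -/

theorem weight_pos (α t : ℝ) {x : ℝ} (hx : x ∈ Set.Ioo (-1 : ℝ) 1) : 0 < weight α t x := by
  have h : 0 < 1 - x ^ 2 := by nlinarith [hx.1, hx.2]
  unfold weight
  positivity

theorem weight_intervalIntegrable {α t : ℝ} (hα : 0 < α) (ht : 0 < t) :
    IntervalIntegrable (weight α t) MeasureTheory.volume (-1) 1 := by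
  have hc : Continuous fun x : ℝ => (1 - x ^ 2) ^ α :=
    (by fun_prop : Continuous fun x : ℝ => 1 - x ^ 2).rpow_const fun _ => Or.inr hα.le
  have hi := hc.intervalIntegrable (μ := MeasureTheory.volume) (-1) 1
  refine hi.mono_fun ?_ ?_
  · have : Measurable (weight α t) := by unfold weight; fun_prop
    exact this.aestronglyMeasurable
  · rw [Set.uIoc_of_le (by norm_num)]
    refine (MeasureTheory.ae_restrict_iff' measurableSet_Ioc).2 (Filter.Eventually.of_forall ?_)
    intro x hx
    have h : 0 ≤ 1 - x ^ 2 := by nlinarith [hx.1, hx.2]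
    show ‖weight α t x‖ ≤ _
    unfold weight
    rw [norm_mul]
    refine mul_le_of_le_one_right (norm_nonneg _) ?_
    rw [Real.norm_eq_abs, Real.abs_exp, Real.exp_le_one_iff]
    have : 0 ≤ t / (1 - x ^ 2) := by positivity
    linarith

theorem form_intervalIntegrable {α t : ℝ} (hα : 0 < α) (ht : 0 < t) (p q : ℝ[X]) :
    IntervalIntegrable (fun x => p.eval x * q.eval x * weight α t x)
      MeasureTheory.volume (-1) 1 :=
  (weight_intervalIntegrable hα ht).continuousOn_mul
    ((p.continuous.mul q.continuous).continuousOn)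

theorem form_comm (α t : ℝ) (p q : ℝ[X]) : form α t p q = form α t q p := by
  unfold form
  congr 1
  ext x
  ring

theorem form_sub_left {α t : ℝ} (hα : 0 < α) (ht : 0 < t) (p q r : ℝ[X]) :
    form α t (p - q) r = form α t p r - form α t q r := by
  unfold form
  rw [← intervalIntegral.integral_sub (form_intervalIntegrable hα ht p r)
    (form_intervalIntegrable hα ht q r)]
  congr 1
  ext x
  simp only [eval_sub]
  ring

theorem form_C_mul_left (α t c : ℝ) (p q : ℝ[X]) :
    form α t (C c * p) q = c * form α t p q := by
  unfold form
  rw [← intervalIntegral.integral_const_mul]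
  congr 1
  ext x
  simp only [eval_mul, eval_C]
  ring

theorem form_sum_left {α t : ℝ} (hα : 0 < α) (ht : 0 < t) {ι : Type*} (s : Finset ι)
    (f : ι → ℝ[X]) (q : ℝ[X]) :
    form α t (∑ i ∈ s, f i) q = ∑ i ∈ s, form α t (f i) q := by
  unfold form
  rw [← intervalIntegral.integral_finsetSum fun i _ => form_intervalIntegrable hα ht (f i) q]
  congr 1
  ext x
  simp only [eval_finsetSum, Finset.sum_mul]

theorem form_self_pos {α t : ℝ} (hα : 0 < α) (ht : 0 < t) {p : ℝ[X]} (hp : p ≠ 0) :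
    0 < form α t p p := by
  unfold form
  refine (intervalIntegral.integral_pos_iff_support_of_nonneg_ae' ?_
    (form_intervalIntegrable hα ht p p)).2 ⟨by norm_num, ?_⟩
  · rw [Set.uIoc_of_le (by norm_num), Filter.EventuallyLE,
      MeasureTheory.ae_restrict_iff' measurableSet_Ioc]
    refine Filter.Eventually.of_forall fun x hx => ?_
    have h : 0 ≤ 1 - x ^ 2 := by nlinarith [hx.1, hx.2]
    have hw : 0 ≤ weight α t x := by unfold weight; positivity
    exact mul_nonneg (mul_self_nonneg _) hw
  · have hsub : Set.Ioo (-1 : ℝ) 1 \ (p.roots.toFinset : Set ℝ) ⊆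
        Function.support (fun x => p.eval x * p.eval x * weight α t x) ∩ Set.Ioc (-1) 1 := by
      rintro x ⟨hx, hr⟩
      refine ⟨?_, hx.1, hx.2.le⟩
      have h0 : p.eval x ≠ 0 := by
        intro h
        apply hr
        simpa [hp] using h
      exact mul_ne_zero (mul_ne_zero h0 h0) (weight_pos α t hx).ne'
    refine lt_of_lt_of_le ?_ (MeasureTheory.measure_mono hsub)
    rw [MeasureTheory.measure_sdiff_null (Finset.measure_zero _ _)]
    simp

theorem P_sub_X_pow_degree (α t : ℝ) (n : ℕ) : (P α t n - X ^ n).degree < (n : WithBot ℕ) := by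
  induction n using Nat.strong_induction_on with
  | _ n ih =>
    rw [P, sub_sub_cancel_left, degree_neg]
    refine (degree_sum_le _ _).trans_lt ((Finset.sup_lt_iff (WithBot.bot_lt_coe n)).2 ?_)
    rintro k -
    rw [C_mul']
    refine (degree_smul_le _ _).trans_lt ?_
    have h := ih k k.2
    have h2 : (P α t k).degree ≤ ((k : ℕ) : WithBot ℕ) := by
      have : P α t k = (P α t k - X ^ (k : ℕ)) + X ^ (k : ℕ) := by ring
      rw [this]
      exact (degree_add_le _ _).trans (max_le h.le (degree_X_pow_le _))
    exact h2.trans_lt (WithBot.coe_lt_coe.2 k.2)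

theorem P_monic (α t : ℝ) (n : ℕ) : (P α t n).Monic := by
  have : P α t n = X ^ n + (P α t n - X ^ n) := by ring
  rw [this]
  exact monic_X_pow_add (P_sub_X_pow_degree α t n)

theorem P_natDegree (α t : ℝ) (n : ℕ) : (P α t n).natDegree = n := by
  have : P α t n = X ^ n + (P α t n - X ^ n) := by ring
  have h := P_sub_X_pow_degree α t n
  apply natDegree_eq_of_degree_eq_some
  rw [this, degree_add_eq_left_of_degree_lt (by rwa [degree_X_pow]), degree_X_pow]

theorem form_P_self_pos {α t : ℝ} (hα : 0 < α) (ht : 0 < t) (n : ℕ) :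
    0 < form α t (P α t n) (P α t n) :=
  form_self_pos hα ht (P_monic α t n).ne_zero

theorem form_P_P_of_lt {α t : ℝ} (hα : 0 < α) (ht : 0 < t) (n : ℕ) :
    ∀ m < n, form α t (P α t n) (P α t m) = 0 := by
  induction n using Nat.strong_induction_on with
  | _ n ih =>
    intro m hm
    rw [P, form_sub_left hα ht, form_sum_left hα ht, Finset.sum_eq_single (⟨m, hm⟩ : Fin n)]
    · rw [form_C_mul_left, div_mul_cancel₀ _ (form_P_self_pos hα ht m).ne', sub_self]
    · intro k _ hk
      have hk' : (k : ℕ) ≠ m := fun h => hk (Fin.ext h)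
      rw [form_C_mul_left]
      rcases lt_or_gt_of_ne hk' with h | h
      · rw [form_comm α t (P α t k) (P α t m), ih m hm k h, mul_zero]
      · rw [ih k k.2 m h, mul_zero]
    · simp

/-- Orthogonality of the polynomials `P_n`. -/
theorem form_P_P {α t : ℝ} (hα : 0 < α) (ht : 0 < t) {m n : ℕ} (h : m ≠ n) :
    form α t (P α t m) (P α t n) = 0 := by
  rcases lt_or_gt_of_ne h with h | h
  · rw [form_comm, form_P_P_of_lt hα ht n m h]
  · exact form_P_P_of_lt hα ht m n h

/-- A family of monic polynomials of degrees `0, 1, 2, …` that are mutually orthogonal for the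
weight is the family `P`. -/
theorem P_unique {α t : ℝ} (hα : 0 < α) (ht : 0 < t) (Q : ℕ → ℝ[X])
    (hmonic : ∀ n, (Q n).Monic) (hdeg : ∀ n, (Q n).natDegree = n)
    (horth : ∀ m n, m ≠ n → form α t (Q m) (Q n) = 0) : Q = P α t := by
  funext n
  induction n using Nat.strong_induction_on with
  | _ n ih =>
    -- a polynomial of degree below `n` is orthogonal to both `Q n` and `P n`
    have key : ∀ d : ℕ, d ≤ n → ∀ r : ℝ[X], r.degree < d →
        form α t r (Q n) = 0 ∧ form α t r (P α t n) = 0 := by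
      intro d
      induction d with
      | zero =>
        intro _ r hr
        have : r = 0 := by
          rw [← degree_eq_bot]
          exact Nat.WithBot.lt_zero_iff.1 hr
        subst this
        simp [form]
      | succ d ihd =>
        intro hd r hr
        have hs : (r - C (r.coeff d) * P α t d).degree < d := by
          rw [degree_lt_iff_coeff_zero]
          intro m hm
          rw [coeff_sub, coeff_C_mul]
          rcases hm.lt_or_eq with h | h
          · rw [coeff_eq_zero_of_degree_lt (hr.trans_le (by exact_mod_cast h)),
              coeff_eq_zero_of_natDegree_lt (p := P α t d) (by rw [P_natDegree]; exact h)]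
            simp
          · subst h
            have := (P_monic α t d).coeff_natDegree
            rw [P_natDegree] at this
            rw [this]
            ring
        have hd' : d ≠ n := by omega
        obtain ⟨h1, h2⟩ := ihd (by omega) _ hs
        rw [form_sub_left hα ht, form_C_mul_left] at h1 h2
        rw [form_P_P hα ht hd'] at h2
        rw [← ih d (by omega), horth d n hd'] at h1
        constructor
        · linarith
        · linarith
    have hlt : (Q n - P α t n).degree < n := by
      have hQ : (Q n).degree = n := by
        rw [degree_eq_natDegree (hmonic n).ne_zero, hdeg]
      have hP : (P α t n).degree = n := by
        rw [degree_eq_natDegree (P_monic α t n).ne_zero, P_natDegree]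
      rw [← hQ]
      exact degree_sub_lt_left (hQ.trans hP.symm) (hmonic n).ne_zero
        (by rw [(hmonic n).leadingCoeff, (P_monic α t n).leadingCoeff])
    obtain ⟨h1, h2⟩ := key n le_rfl _ hlt
    by_contra hne
    have hpos := form_self_pos hα ht (sub_ne_zero.2 hne)
    rw [form_sub_left hα ht, form_comm α t (Q n), form_comm α t (P α t n), h1, h2] at hpos
    simp at hpos

end PollaczekJacobi

end

noncomputable section

namespace PollaczekJacobi

/-! ### Moments and integration by parts -/

/-! The weight satisfies a Pearson equation with leading factor (1 - x²)², so (1 - x²)² P_n' is a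
combination of P_n and P_{n-1} with polynomial coefficients of bounded degree (`lowering`; `raising`
uses P_{n+1} instead). Since the weight is even, these coefficients contain only two nontrivial
scalars besides β_n, namely `ladderA` and `ladderB`, and both are linear in neighbouring subleading
coefficients.

Compatibility with the three-term recurrence gives `beta_mul_ladderA`, from which three identities
follow by induction: `sumA_eq_beta_mul`, `ladderB_sq` and `sumA_eq_linear`. Up to an index shift
they are the coefficients of 1, x² and x⁴ in the ladder identity B_n² + v' B_n + ∑_{j<n} A_j = β_n
A_n A_{n-1}, v = -log w, after multiplication by (1 - x²)⁴. Eliminating the sum and A_n, the only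
term that involves p(n+2), leaves a relation between p(n-1), p(n) and p(n+1). -/

theorem form_mul_one (α t : ℝ) (p q : ℝ[X]) : form α t (p * q) 1 = form α t p q := by
  simp [form]

/-- The moment functional `f ↦ ∫ f w`. -/
def moment {α t : ℝ} (hα : 0 < α) (ht : 0 < t) : ℝ[X] →ₗ[ℝ] ℝ where
  toFun f := form α t f 1
  map_add' p q := by
    have h := form_sub_left hα ht (p + q) q 1
    rw [add_sub_cancel_right] at h
    linarith
  map_smul' c p := by
    rw [smul_eq_C_mul, form_C_mul_left]
    rfl

theorem moment_mul {α t : ℝ} (hα : 0 < α) (ht : 0 < t) (p q : ℝ[X]) :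
    moment hα ht (p * q) = form α t p q :=
  form_mul_one α t p q

theorem moment_C_mul {α t : ℝ} (hα : 0 < α) (ht : 0 < t) (c : ℝ) (p : ℝ[X]) :
    moment hα ht (C c * p) = c * moment hα ht p := by
  rw [← smul_eq_C_mul, map_smul, smul_eq_mul]

/-- The weight satisfies a Pearson equation. -/
theorem hasDerivAt_weight (α t : ℝ) {x : ℝ} (hx : x ∈ Set.Ioo (-1 : ℝ) 1) :
    HasDerivAt (weight α t)
      (-(2 * α * x / (1 - x ^ 2) + 2 * t * x / (1 - x ^ 2) ^ 2) * weight α t x) x := by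
  have h : 0 < 1 - x ^ 2 := by nlinarith [hx.1, hx.2]
  have h1 : HasDerivAt (fun y : ℝ => 1 - y ^ 2) (-(2 * x)) x := by
    simpa using (hasDerivAt_pow 2 x).const_sub 1
  have h2 := h1.rpow_const (p := α) (Or.inl h.ne')
  have h3 := ((((hasDerivAt_const x t).div h1 h.ne')).neg).exp
  have h4 := h2.mul h3
  refine h4.congr_deriv ?_
  simp only [weight, Pi.div_apply, Pi.neg_apply]
  rw [Real.rpow_sub_one h.ne']
  field_simp
  ring

/-- At the end points the division by zero is harmless: the factor 0 ^ α is 0, and nearby the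
exponential is at most 1, so the weight is squeezed by (1 - x²)^α. -/
theorem continuousOn_weight {α t : ℝ} (hα : 0 < α) (ht : 0 < t) :
    ContinuousOn (weight α t) (Set.Icc (-1) 1) := by
  intro x hx
  have hc : Continuous fun x : ℝ => (1 - x ^ 2) ^ α :=
    (by fun_prop : Continuous fun x : ℝ => 1 - x ^ 2).rpow_const fun _ => Or.inr hα.le
  by_cases hx' : x ∈ Set.Ioo (-1 : ℝ) 1
  · exact (hasDerivAt_weight α t hx').continuousAt.continuousWithinAt
  · have h0 : 1 - x ^ 2 = 0 := by
      have : x = -1 ∨ x = 1 := by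
        by_contra hne
        rw [not_or] at hne
        exact hx' ⟨lt_of_le_of_ne hx.1 (Ne.symm hne.1), lt_of_le_of_ne hx.2 hne.2⟩
      rcases this with rfl | rfl <;> norm_num
    have hw : weight α t x = 0 := by simp [weight, h0, Real.zero_rpow hα.ne']
    have hlim := (hc.tendsto x).mono_left (nhdsWithin_le_nhds (s := Set.Icc (-1 : ℝ) 1))
    rw [h0, Real.zero_rpow hα.ne'] at hlim
    rw [ContinuousWithinAt, hw]
    refine squeeze_zero_norm' ?_ hlim
    filter_upwards [self_mem_nhdsWithin] with y hy
    have h : 0 ≤ 1 - y ^ 2 := by nlinarith [hy.1, hy.2]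
    have h2 : 0 ≤ t / (1 - y ^ 2) := by positivity
    unfold weight
    rw [Real.norm_of_nonneg (by positivity)]
    refine mul_le_of_le_one_right (by positivity) ?_
    rw [Real.exp_le_one_iff]
    linarith

/-- Integration by parts against the weight. -/
theorem moment_pearson {α t : ℝ} (hα : 0 < α) (ht : 0 < t) (f : ℝ[X]) :
    moment hα ht ((1 - X ^ 2) ^ 2 * derivative f
      + (C (4 + 2 * α) * X ^ 3 - C (4 + 2 * α + 2 * t) * X) * f) = 0 := by
  set g : ℝ[X] := (1 - X ^ 2) ^ 2 * derivative f
      + (C (4 + 2 * α) * X ^ 3 - C (4 + 2 * α + 2 * t) * X) * f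
  -- The integrand is the derivative of (1 - x²)² f w. The factor (1 - x²)² clears the double poles
  -- of w'/w and makes the boundary terms vanish.
  have hd : ∀ x ∈ Set.Ioo (-1 : ℝ) 1,
      HasDerivAt (fun y => ((1 - X ^ 2) ^ 2 * f).eval y * weight α t y)
        (g.eval x * (1 : ℝ[X]).eval x * weight α t x) x := by
    intro x hx
    have h : 0 < 1 - x ^ 2 := by nlinarith [hx.1, hx.2]
    refine (((1 - X ^ 2) ^ 2 * f).hasDerivAt x |>.mul (hasDerivAt_weight α t hx)).congr_deriv ?_
    simp [g, derivative_pow]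
    field_simp
    ring
  have hc : ContinuousOn (fun y => ((1 - X ^ 2) ^ 2 * f).eval y * weight α t y)
      (Set.Icc (-1) 1) :=
    (Polynomial.continuous _).continuousOn.mul (continuousOn_weight hα ht)
  have := intervalIntegral.integral_eq_sub_of_hasDerivAt_of_le (by norm_num) hc hd
    (form_intervalIntegrable hα ht g 1)
  change ∫ x in (-1 : ℝ)..1, g.eval x * (1 : ℝ[X]).eval x * weight α t x = 0
  rw [this]
  simp

/-! ### Orthogonality and parity -/

theorem moment_P_mul_of_degree_lt {α t : ℝ} (hα : 0 < α) (ht : 0 < t) {n : ℕ} :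
    ∀ d : ℕ, d ≤ n → ∀ f : ℝ[X], f.degree < d → moment hα ht (P α t n * f) = 0 := by
  intro d
  induction d with
  | zero =>
    intro _ f hf
    have : f = 0 := degree_eq_bot.1 (Nat.WithBot.lt_zero_iff.1 hf)
    simp [this]
  | succ d ih =>
    intro hd f hf
    have hs : (f - C (f.coeff d) * P α t d).degree < d := by
      rw [degree_lt_iff_coeff_zero]
      intro m hm
      rw [coeff_sub, coeff_C_mul]
      rcases hm.lt_or_eq with h | h
      · rw [coeff_eq_zero_of_degree_lt (hf.trans_le (by exact_mod_cast h)),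
          coeff_eq_zero_of_natDegree_lt (p := P α t d) (by rw [P_natDegree]; exact h)]
        simp
      · subst h
        have := (P_monic α t d).coeff_natDegree
        rw [P_natDegree] at this
        rw [this]
        ring
    have h1 := ih (by omega) _ hs
    have h2 : P α t n * f = P α t n * (f - C (f.coeff d) * P α t d)
        + C (f.coeff d) * (P α t n * P α t d) := by ring
    rw [h2, map_add, h1, moment_C_mul, moment_mul, form_P_P hα ht (by omega)]
    simp

theorem form_comp_neg (α t : ℝ) (p q : ℝ[X]) :
    form α t (p.comp (-X)) (q.comp (-X)) = form α t p q := by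
  have h := intervalIntegral.integral_comp_neg (a := (-1 : ℝ)) (b := 1)
    (fun x => p.eval x * q.eval x * weight α t x)
  rw [neg_neg] at h
  rw [form, form, ← h]
  simp [weight, eval_comp]

theorem coeff_comp_neg_X (p : ℝ[X]) (k : ℕ) : (p.comp (-X)).coeff k = (-1) ^ k * p.coeff k := by
  have h : (-X : ℝ[X]) = C (-1) * X := by simp
  rw [h, comp_C_mul_X_coeff, mul_comm]

/-- The weight is even, so the reflected, sign-corrected family is again monic and orthogonal;
`P_unique` identifies it with `P`. -/
theorem P_comp_neg {α t : ℝ} (hα : 0 < α) (ht : 0 < t) (n : ℕ) :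
    C ((-1) ^ n) * (P α t n).comp (-X) = P α t n := by
  have hcoeff : ∀ n k, (C ((-1 : ℝ) ^ n) * (P α t n).comp (-X)).coeff k
      = (-1) ^ n * ((-1) ^ k * (P α t n).coeff k) := by
    intro n k
    rw [coeff_C_mul, coeff_comp_neg_X]
  have htop : ∀ n, (P α t n).coeff n = 1 := fun n => by
    have := (P_monic α t n).coeff_natDegree
    rwa [P_natDegree] at this
  have hdeg : ∀ n, (C ((-1 : ℝ) ^ n) * (P α t n).comp (-X)).natDegree = n := by
    intro n
    refine natDegree_eq_of_le_of_coeff_ne_zero ?_ ?_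
    · rw [natDegree_le_iff_coeff_eq_zero]
      intro k hk
      rw [hcoeff, coeff_eq_zero_of_natDegree_lt (by rwa [P_natDegree])]
      simp
    · rw [hcoeff, htop, mul_one, ← mul_pow]
      simp
  refine congrFun (P_unique hα ht (fun n => C ((-1) ^ n) * (P α t n).comp (-X)) ?_ hdeg ?_) n
  · intro n
    change leadingCoeff _ = 1
    rw [leadingCoeff, hdeg, hcoeff, htop, mul_one, ← mul_pow]
    simp
  · intro m n hmn
    rw [form_C_mul_left, form_comm, form_C_mul_left, form_comp_neg, form_P_P hα ht hmn.symm]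
    simp

theorem P_coeff_eq_zero_of_odd_add {α t : ℝ} (hα : 0 < α) (ht : 0 < t) {n k : ℕ}
    (h : Odd (n + k)) : (P α t n).coeff k = 0 := by
  have h1 := congrArg (fun f => coeff f k) (P_comp_neg hα ht n)
  simp only [coeff_C_mul, coeff_comp_neg_X] at h1
  rw [← mul_assoc, ← pow_add, h.neg_one_pow] at h1
  linarith

/-! ### Coefficients indexed by integers -/

/-- The coefficient of `X ^ j`, for an integer `j`; it is zero for negative `j`. -/
def zcoeff (f : ℝ[X]) (j : ℤ) : ℝ :=
  if 0 ≤ j then f.coeff j.toNat else 0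

theorem zcoeff_natCast (f : ℝ[X]) (k : ℕ) : zcoeff f k = f.coeff k := by
  simp [zcoeff]

theorem zcoeff_of_neg (f : ℝ[X]) {j : ℤ} (h : j < 0) : zcoeff f j = 0 := by
  simp [zcoeff, h]

theorem zcoeff_add (f g : ℝ[X]) (j : ℤ) : zcoeff (f + g) j = zcoeff f j + zcoeff g j := by
  unfold zcoeff
  split_ifs <;> simp

theorem zcoeff_sub (f g : ℝ[X]) (j : ℤ) : zcoeff (f - g) j = zcoeff f j - zcoeff g j := by
  unfold zcoeff
  split_ifs <;> simp

theorem zcoeff_C_mul (c : ℝ) (f : ℝ[X]) (j : ℤ) : zcoeff (C c * f) j = c * zcoeff f j := by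
  unfold zcoeff
  split_ifs <;> simp

/-- Integer indices make this shift rule uniform, so later coefficient comparisons need no separate
treatment of small degrees. -/
theorem zcoeff_X_mul (f : ℝ[X]) (j : ℤ) : zcoeff (X * f) j = zcoeff f (j - 1) := by
  rcases lt_trichotomy j 0 with h | h | h
  · rw [zcoeff_of_neg _ h, zcoeff_of_neg _ (by omega)]
  · subst h
    rw [zcoeff_of_neg f (by norm_num : (0 : ℤ) - 1 < 0)]
    simp [zcoeff]
  · obtain ⟨k, rfl⟩ : ∃ k : ℕ, j = ((k + 1 : ℕ) : ℤ) := ⟨(j - 1).toNat, by omega⟩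
    rw [zcoeff_natCast, coeff_X_mul, ← zcoeff_natCast]
    congr 1
    push_cast
    ring

theorem zcoeff_derivative (f : ℝ[X]) (j : ℤ) :
    zcoeff (derivative f) j = (j + 1) * zcoeff f (j + 1) := by
  rcases lt_or_ge j 0 with h | h
  · rw [zcoeff_of_neg _ h]
    rcases eq_or_ne j (-1) with rfl | h'
    · simp
    · rw [zcoeff_of_neg _ (by omega), mul_zero]
  · obtain ⟨k, rfl⟩ := Int.eq_ofNat_of_zero_le h
    rw [zcoeff_natCast, coeff_derivative, ← zcoeff_natCast]
    push_cast
    ring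

theorem zcoeff_P_self (α t : ℝ) (n : ℕ) : zcoeff (P α t n) n = 1 := by
  have := (P_monic α t n).coeff_natDegree
  rwa [P_natDegree, ← zcoeff_natCast] at this

theorem zcoeff_P_of_gt (α t : ℝ) (n : ℕ) {j : ℤ} (h : (n : ℤ) < j) : zcoeff (P α t n) j = 0 := by
  obtain ⟨k, rfl⟩ := Int.eq_ofNat_of_zero_le (by omega : 0 ≤ j)
  rw [zcoeff_natCast]
  exact coeff_eq_zero_of_natDegree_lt (by rw [P_natDegree]; omega)

theorem zcoeff_P_of_odd {α t : ℝ} (hα : 0 < α) (ht : 0 < t) (n : ℕ) {j : ℤ}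
    (h : Odd ((n : ℤ) - j)) : zcoeff (P α t n) j = 0 := by
  rcases lt_or_ge j 0 with hj | hj
  · exact zcoeff_of_neg _ hj
  · obtain ⟨k, rfl⟩ := Int.eq_ofNat_of_zero_le hj
    rw [zcoeff_natCast]
    refine P_coeff_eq_zero_of_odd_add hα ht ?_
    have h2 : Odd ((n : ℤ) + k) := by
      have := h.add_even (even_two_mul (k : ℤ))
      convert this using 1
      ring
    exact_mod_cast h2

/-- The convention p(0) = p(1) = 0 agrees with the vanishing of coefficients at negative indices, so
no lower bound on n is needed. -/
theorem zcoeff_P_sub_two {α t : ℝ} (n : ℕ) :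
    zcoeff (P α t n) (n - 2) = subleadingCoeff α t n := by
  unfold subleadingCoeff
  split_ifs with h
  · rw [← zcoeff_natCast]
    congr 1
    omega
  · exact zcoeff_of_neg _ (by omega)

theorem degree_lt_of_zcoeff {f : ℝ[X]} {n : ℕ} (h : ∀ j : ℤ, (n : ℤ) ≤ j → zcoeff f j = 0) :
    f.degree < n := by
  rw [degree_lt_iff_coeff_zero]
  intro m hm
  rw [← zcoeff_natCast]
  exact h m (by exact_mod_cast hm)

/-! ### Pairing with `P n` -/

/-- Expand f in the orthogonal basis: only its P_n component survives. By parity P_{n+1} has no X^n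
term, so the component is the X^n coefficient corrected only by the P_{n+2} part. -/
theorem moment_P_mul {α t : ℝ} (hα : 0 < α) (ht : 0 < t) (n : ℕ) (f : ℝ[X])
    (hf : ∀ j : ℤ, (n : ℤ) + 2 < j → zcoeff f j = 0) :
    moment hα ht (P α t n * f) =
      (zcoeff f n - subleadingCoeff α t (n + 2) * zcoeff f (n + 2)) *
        form α t (P α t n) (P α t n) := by
  set c2 := zcoeff f (n + 2)
  set c1 := zcoeff f (n + 1)
  set c0 := zcoeff f n - subleadingCoeff α t (n + 2) * c2
  set g := f - C c2 * P α t (n + 2) - C c1 * P α t (n + 1) - C c0 * P α t n with hg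
  have hlow : g.degree < n := by
    refine degree_lt_of_zcoeff fun j hj => ?_
    simp only [hg, zcoeff_sub, zcoeff_C_mul]
    obtain h | h | h | h : j = n ∨ j = n + 1 ∨ j = n + 2 ∨ (n : ℤ) + 2 < j := by omega
    · subst h
      have h2 := zcoeff_P_sub_two (α := α) (t := t) (n + 2)
      push_cast at h2
      rw [add_sub_cancel_right] at h2
      rw [h2, zcoeff_P_of_odd hα ht (n + 1) (by push_cast; simp), zcoeff_P_self]
      ring
    · subst h
      have h1 := zcoeff_P_self α t (n + 1)
      push_cast at h1
      rw [h1, zcoeff_P_of_odd hα ht (n + 2) (by push_cast; ring_nf; simp),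
        zcoeff_P_of_gt α t n (by omega)]
      ring
    · subst h
      have h1 := zcoeff_P_self α t (n + 2)
      push_cast at h1
      rw [h1, zcoeff_P_of_gt α t (n + 1) (by push_cast; omega), zcoeff_P_of_gt α t n (by omega)]
      ring
    · rw [hf j h, zcoeff_P_of_gt α t (n + 1) (by push_cast; omega),
        zcoeff_P_of_gt α t (n + 2) (by push_cast; omega), zcoeff_P_of_gt α t n (by omega)]
      ring
  have hexp : P α t n * f = P α t n * g + C c2 * (P α t n * P α t (n + 2))
      + C c1 * (P α t n * P α t (n + 1)) + C c0 * (P α t n * P α t n) := by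
    rw [hg]
    ring
  rw [hexp, map_add, map_add, map_add, moment_P_mul_of_degree_lt hα ht n le_rfl g hlow,
    moment_C_mul, moment_C_mul, moment_C_mul, moment_mul, moment_mul, moment_mul,
    form_P_P hα ht (by omega), form_P_P hα ht (by omega)]
  ring

/-- A polynomial of degree less than `n` that is orthogonal to `P 0, …, P (n - 1)` vanishes. -/
theorem eq_zero_of_moment_P_mul {α t : ℝ} (hα : 0 < α) (ht : 0 < t) (f : ℝ[X]) :
    ∀ n : ℕ, f.degree < n → (∀ k < n, moment hα ht (P α t k * f) = 0) → f = 0 := by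
  intro n
  induction n with
  | zero => exact fun h _ => degree_eq_bot.1 (Nat.WithBot.lt_zero_iff.1 h)
  | succ n ih =>
    intro hd h
    have hz : ∀ j : ℤ, (n : ℤ) < j → zcoeff f j = 0 := by
      intro j hj
      obtain ⟨k, rfl⟩ := Int.eq_ofNat_of_zero_le (by omega : 0 ≤ j)
      rw [zcoeff_natCast]
      exact (degree_lt_iff_coeff_zero f _).1 hd k (by omega)
    refine ih (degree_lt_of_zcoeff fun j hj => ?_) fun k hk => h k (by omega)
    rcases hj.lt_or_eq with hj | rfl
    · exact hz j hj
    · have h1 := h n (by omega)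
      rw [moment_P_mul hα ht n f fun j hj => hz j (by omega), hz (n + 2) (by omega)] at h1
      have h2 := (form_P_self_pos hα ht n).ne'
      simpa [h2] using h1

/-! ### The three-term recurrence -/

/-- The coefficient `β n` of the recurrence `x P n = P (n + 1) + β n P (n - 1)`. -/
def beta (α t : ℝ) (n : ℕ) : ℝ :=
  subleadingCoeff α t n - subleadingCoeff α t (n + 1)

theorem subleadingCoeff_zero (α t : ℝ) : subleadingCoeff α t 0 = 0 := by
  simp [subleadingCoeff]

theorem subleadingCoeff_one (α t : ℝ) : subleadingCoeff α t 1 = 0 := by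
  simp [subleadingCoeff]

theorem P_zero (α t : ℝ) : P α t 0 = 1 := by
  rw [P]
  simp

theorem P_one {α t : ℝ} (hα : 0 < α) (ht : 0 < t) : P α t 1 = X := by
  have h1 := zcoeff_P_self α t 1
  have h0 := zcoeff_P_of_odd hα ht 1 (j := 0) (by simp)
  rw [zcoeff_natCast] at h1
  rw [show (0 : ℤ) = ((0 : ℕ) : ℤ) from rfl, zcoeff_natCast] at h0
  have := eq_X_add_C_of_natDegree_le_one (P_natDegree α t 1).le
  rw [this, h1, h0]
  simp

/-- Evaluate ∫ x P_n P_{n+1} w in two ways, letting x act on either factor. -/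
theorem form_P_succ {α t : ℝ} (hα : 0 < α) (ht : 0 < t) (n : ℕ) :
    form α t (P α t (n + 1)) (P α t (n + 1)) =
      beta α t (n + 1) * form α t (P α t n) (P α t n) := by
  have h1 := moment_P_mul hα ht (n + 1) (X * P α t n) fun j hj => by
    rw [zcoeff_X_mul]
    exact zcoeff_P_of_gt α t n (by push_cast at hj; omega)
  have h2 := moment_P_mul hα ht n (X * P α t (n + 1)) fun j hj => by
    rw [zcoeff_X_mul]
    exact zcoeff_P_of_gt α t (n + 1) (by push_cast; omega)
  have h3 : P α t n * (X * P α t (n + 1)) = P α t (n + 1) * (X * P α t n) := by ring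
  have e1 : ((n : ℤ) + 1) - 1 = n := by ring
  have e2 : ((n : ℤ) + 1) + 2 - 1 = n + 2 := by ring
  have e3 : ((n : ℤ) + 2) - 1 = (n + 1 : ℕ) := by push_cast; ring
  have e4 : (n : ℤ) - 1 = (n + 1 : ℕ) - 2 := by push_cast; ring
  rw [h3, h1] at h2
  rw [zcoeff_X_mul, zcoeff_X_mul, zcoeff_X_mul, zcoeff_X_mul] at h2
  push_cast at h2
  rw [e1, e2, zcoeff_P_self, zcoeff_P_of_gt α t n (by omega : (n : ℤ) < n + 2), e3,
    zcoeff_P_self, e4, zcoeff_P_sub_two] at h2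
  rw [beta]
  linear_combination h2

theorem P_add_two {α t : ℝ} (hα : 0 < α) (ht : 0 < t) (n : ℕ) :
    P α t (n + 2) = X * P α t (n + 1) - C (beta α t (n + 1)) * P α t n := by
  rw [← sub_eq_zero]
  refine eq_zero_of_moment_P_mul hα ht _ (n + 1) (degree_lt_of_zcoeff fun j hj => ?_) fun k hk => ?_
  · simp only [zcoeff_sub, zcoeff_C_mul, zcoeff_X_mul]
    push_cast at hj
    rw [zcoeff_P_of_gt α t n (by omega)]
    obtain h | h | h : j = n + 1 ∨ j = n + 2 ∨ (n : ℤ) + 2 < j := by omega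
    · subst h
      rw [zcoeff_P_of_odd hα ht (n + 2) (by push_cast; ring_nf; simp),
        zcoeff_P_of_odd hα ht (n + 1) (by push_cast; ring_nf; simp)]
      ring
    · subst h
      have h1 := zcoeff_P_self α t (n + 1)
      have h2 := zcoeff_P_self α t (n + 2)
      push_cast at h1 h2
      rw [h2, show (n : ℤ) + 2 - 1 = n + 1 by ring, h1]
      ring
    · rw [zcoeff_P_of_gt α t (n + 2) (by push_cast; omega),
        zcoeff_P_of_gt α t (n + 1) (by push_cast; omega)]
      ring
  · have e : P α t k * (P α t (n + 2) - (X * P α t (n + 1) - C (beta α t (n + 1)) * P α t n))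
        = P α t k * P α t (n + 2) - P α t (n + 1) * (X * P α t k)
          + C (beta α t (n + 1)) * (P α t k * P α t n) := by ring
    have hX : moment hα ht (P α t (n + 1) * (X * P α t k)) =
        zcoeff (P α t k) n * form α t (P α t (n + 1)) (P α t (n + 1)) := by
      rw [moment_P_mul hα ht (n + 1) _ fun j hj => by
        rw [zcoeff_X_mul]
        exact zcoeff_P_of_gt α t k (by push_cast at hj; omega)]
      rw [zcoeff_X_mul, zcoeff_X_mul, zcoeff_P_of_gt α t k (j := ((n + 1 : ℕ) : ℤ) + 2 - 1)
        (by push_cast; omega)]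
      push_cast
      rw [add_sub_cancel_right]
      ring
    rw [e, map_add, map_sub, moment_C_mul, hX, moment_mul, moment_mul, form_P_P hα ht (by omega)]
    rcases (Nat.lt_succ_iff.1 hk).lt_or_eq with h | rfl
    · rw [form_P_P hα ht h.ne, zcoeff_P_of_gt α t k (by omega)]
      ring
    · rw [zcoeff_P_self, form_P_succ hα ht]
      ring

/-! ### The lowering relation -/

/-- The coefficient of `x` in the ladder coefficient `B n`, multiplied by `(1 - x²)²`. -/
def ladderB (α t : ℝ) (n : ℕ) : ℝ :=
  2 * n + 2 * subleadingCoeff α t n - (2 * n + 1 + 2 * α) * beta α t n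

/-- The constant term of the ladder coefficient `A n`, multiplied by `(1 - x²)²`. -/
def ladderA (α t : ℝ) (n : ℕ) : ℝ :=
  ladderB α t (n + 1) + ladderB α t n + 2 * α + 2 * t

/-- The difference of the two sides of the lowering relation. -/
def loweringDefect (α t : ℝ) (n : ℕ) : ℝ[X] :=
  (1 - X ^ 2) ^ 2 * derivative (P α t (n + 1))
    + (C (ladderB α t (n + 1)) * X - C ((n : ℝ) + 1) * X ^ 3) * P α t (n + 1)
    - C (beta α t (n + 1)) *
      ((C (ladderA α t (n + 1)) - C (2 * n + 3 + 2 * α) * X ^ 2) * P α t n)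

theorem zcoeff_sigma_mul_derivative (f : ℝ[X]) (j : ℤ) :
    zcoeff ((1 - X ^ 2) ^ 2 * derivative f) j =
      (j - 3) * zcoeff f (j - 3) - 2 * (j - 1) * zcoeff f (j - 1)
        + (j + 1) * zcoeff f (j + 1) := by
  have h : (1 - X ^ 2) ^ 2 * derivative f = X * (X * (X * (X * derivative f)))
      - C 2 * (X * (X * derivative f)) + derivative f := by
    rw [C_ofNat]
    ring
  rw [h]
  simp only [zcoeff_add, zcoeff_sub, zcoeff_C_mul, zcoeff_X_mul, zcoeff_derivative]
  have e1 : j - 1 - 1 - 1 - 1 + 1 = j - 3 := by ring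
  have e2 : j - 1 - 1 + 1 = j - 1 := by ring
  rw [e1, e2]
  push_cast
  ring

theorem zcoeff_odd_cubic_mul (a b : ℝ) (f : ℝ[X]) (j : ℤ) :
    zcoeff ((C a * X - C b * X ^ 3) * f) j = a * zcoeff f (j - 1) - b * zcoeff f (j - 3) := by
  have h : (C a * X - C b * X ^ 3) * f = C a * (X * f) - C b * (X * (X * (X * f))) := by ring
  rw [h]
  simp only [zcoeff_sub, zcoeff_C_mul, zcoeff_X_mul]
  rw [show j - 1 - 1 - 1 = j - 3 by ring]

theorem zcoeff_even_quadratic_mul (a b : ℝ) (f : ℝ[X]) (j : ℤ) :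
    zcoeff ((C a - C b * X ^ 2) * f) j = a * zcoeff f j - b * zcoeff f (j - 2) := by
  have h : (C a - C b * X ^ 2) * f = C a * f - C b * (X * (X * f)) := by ring
  rw [h]
  simp only [zcoeff_sub, zcoeff_C_mul, zcoeff_X_mul]
  rw [show j - 1 - 1 = j - 2 by ring]

/-- The coefficients of `P n` from degree `n - 3` on. -/
theorem zcoeff_P {α t : ℝ} (hα : 0 < α) (ht : 0 < t) (n : ℕ) {j : ℤ} (hj : (n : ℤ) - 3 ≤ j) :
    zcoeff (P α t n) j =
      if j = n then 1 else if j = n - 2 then subleadingCoeff α t n else 0 := by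
  split_ifs with h1 h2
  · rw [h1, zcoeff_P_self]
  · rw [h2, zcoeff_P_sub_two]
  · rcases lt_or_ge (n : ℤ) j with h | h
    · exact zcoeff_P_of_gt α t n h
    · obtain h | h : j = n - 3 ∨ j = n - 1 := by omega
      · subst h
        exact zcoeff_P_of_odd hα ht n ⟨1, by ring⟩
      · subst h
        exact zcoeff_P_of_odd hα ht n ⟨0, by ring⟩

/-- Parity removes the coefficients of X^(n+1) and X^(n+3), and the cubic term cancels X^(n+4).
Cancellation at X^(n+2) is what dictates the formula for `ladderB`. -/
theorem degree_loweringDefect_lt {α t : ℝ} (hα : 0 < α) (ht : 0 < t) (n : ℕ) :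
    (loweringDefect α t n).degree < (n + 1 : ℕ) := by
  refine degree_lt_of_zcoeff fun j hj => ?_
  rw [loweringDefect, zcoeff_sub, zcoeff_add, zcoeff_sigma_mul_derivative, zcoeff_odd_cubic_mul,
    zcoeff_C_mul, zcoeff_even_quadratic_mul]
  push_cast at hj
  have hz : ∀ i : ℤ, (n : ℤ) - 2 ≤ i → zcoeff (P α t (n + 1)) i =
      if i = n + 1 then 1 else if i = n - 1 then subleadingCoeff α t (n + 1) else 0 := by
    intro i hi
    rw [zcoeff_P hα ht (n + 1) (by push_cast; omega)]
    push_cast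
    rw [show (n : ℤ) + 1 - 2 = n - 1 by ring]
  rw [hz _ (by omega), hz _ (by omega), hz _ (by omega), zcoeff_P hα ht n (by omega),
    zcoeff_P hα ht n (by omega)]
  obtain h | h | h | h | h : j = n + 1 ∨ j = n + 2 ∨ j = n + 3 ∨ j = n + 4 ∨ (n : ℤ) + 4 < j := by
    omega
  · subst h
    simp only [show ¬ ((n : ℤ) + 1 - 3 = n + 1) by omega, show ¬ ((n : ℤ) + 1 - 3 = n - 1) by omega,
      show ¬ ((n : ℤ) + 1 - 1 = n + 1) by omega, show ¬ ((n : ℤ) + 1 - 1 = n - 1) by omega,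
      show ¬ ((n : ℤ) + 1 + 1 = n + 1) by omega, show ¬ ((n : ℤ) + 1 + 1 = n - 1) by omega,
      show ¬ ((n : ℤ) + 1 = n) by omega, show ¬ ((n : ℤ) + 1 = n - 2) by omega,
      show ¬ ((n : ℤ) + 1 - 2 = n) by omega, show ¬ ((n : ℤ) + 1 - 2 = n - 2) by omega, if_false]
    ring
  · subst h
    simp only [show ((n : ℤ) + 2 - 3 = n - 1) by omega, show ¬ ((n : ℤ) - 1 = n + 1) by omega,
      show ((n : ℤ) + 2 - 1 = n + 1) by omega,
      show ¬ ((n : ℤ) + 2 + 1 = n + 1) by omega, show ¬ ((n : ℤ) + 2 + 1 = n - 1) by omega,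
      show ¬ ((n : ℤ) + 2 = n) by omega, show ¬ ((n : ℤ) + 2 = n - 2) by omega,
      show ((n : ℤ) + 2 - 2 = n) by omega, if_false, if_true]
    rw [ladderB]
    push_cast
    ring
  · subst h
    simp only [show ((n : ℤ) + 3 - 3 = n) by omega, show ¬ ((n : ℤ) = n + 1) by omega,
      show ¬ ((n : ℤ) = n - 1) by omega,
      show ¬ ((n : ℤ) + 3 - 1 = n + 1) by omega, show ¬ ((n : ℤ) + 3 - 1 = n - 1) by omega,
      show ¬ ((n : ℤ) + 3 + 1 = n + 1) by omega, show ¬ ((n : ℤ) + 3 + 1 = n - 1) by omega,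
      show ¬ ((n : ℤ) + 3 = n) by omega, show ¬ ((n : ℤ) + 3 = n - 2) by omega,
      show ¬ ((n : ℤ) + 3 - 2 = n) by omega, show ¬ ((n : ℤ) + 3 - 2 = n - 2) by omega, if_false]
    ring
  · subst h
    simp only [show ((n : ℤ) + 4 - 3 = n + 1) by omega,
      show ¬ ((n : ℤ) + 4 - 1 = n + 1) by omega, show ¬ ((n : ℤ) + 4 - 1 = n - 1) by omega,
      show ¬ ((n : ℤ) + 4 + 1 = n + 1) by omega, show ¬ ((n : ℤ) + 4 + 1 = n - 1) by omega,
      show ¬ ((n : ℤ) + 4 = n) by omega, show ¬ ((n : ℤ) + 4 = n - 2) by omega,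
      show ¬ ((n : ℤ) + 4 - 2 = n) by omega, show ¬ ((n : ℤ) + 4 - 2 = n - 2) by omega,
      if_false, if_true]
    push_cast
    ring
  · simp only [show ¬ (j - 3 = n + 1) by omega, show ¬ (j - 3 = n - 1) by omega,
      show ¬ (j - 1 = n + 1) by omega, show ¬ (j - 1 = n - 1) by omega,
      show ¬ (j + 1 = n + 1) by omega, show ¬ (j + 1 = n - 1) by omega,
      show ¬ (j = n) by omega, show ¬ (j = n - 2) by omega,
      show ¬ (j - 2 = n) by omega, show ¬ (j - 2 = n - 2) by omega, if_false]
    ring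

/-- Integration by parts moves the derivative from P_{n+1} to P_k, after which `moment_P_mul`
evaluates every term. -/
theorem moment_P_mul_loweringDefect {α t : ℝ} (hα : 0 < α) (ht : 0 < t) (n k : ℕ) (hk : k ≤ n) :
    moment hα ht (P α t k * loweringDefect α t n) = 0 := by
  have hp := moment_pearson hα ht (P α t (n + 1) * P α t k)
  set F : ℝ[X] := (C (ladderB α t (n + 1) + (4 + 2 * α + 2 * t)) * X
    - C ((n : ℝ) + 1 + (4 + 2 * α)) * X ^ 3) * P α t k
      - (1 - X ^ 2) ^ 2 * derivative (P α t k) with hF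
  set G : ℝ[X] := (C (ladderA α t (n + 1)) - C (2 * n + 3 + 2 * α) * X ^ 2) * P α t k with hG
  have e : P α t k * loweringDefect α t n =
      ((1 - X ^ 2) ^ 2 * derivative (P α t (n + 1) * P α t k)
        + (C (4 + 2 * α) * X ^ 3 - C (4 + 2 * α + 2 * t) * X) * (P α t (n + 1) * P α t k))
      + P α t (n + 1) * F - C (beta α t (n + 1)) * (P α t n * G) := by
    rw [hF, hG, loweringDefect, derivative_mul]
    simp only [map_add]
    ring
  have zF : ∀ j, zcoeff F j = (ladderB α t (n + 1) + (4 + 2 * α + 2 * t)) * zcoeff (P α t k) (j - 1)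
      - ((n : ℝ) + 1 + (4 + 2 * α)) * zcoeff (P α t k) (j - 3)
      - ((j - 3) * zcoeff (P α t k) (j - 3) - 2 * (j - 1) * zcoeff (P α t k) (j - 1)
        + (j + 1) * zcoeff (P α t k) (j + 1)) := by
    intro j
    rw [hF, zcoeff_sub, zcoeff_odd_cubic_mul, zcoeff_sigma_mul_derivative]
  have zG : ∀ j, zcoeff G j = ladderA α t (n + 1) * zcoeff (P α t k) j
      - (2 * n + 3 + 2 * α) * zcoeff (P α t k) (j - 2) := by
    intro j
    rw [hG, zcoeff_even_quadratic_mul]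
  have hFd : ∀ j : ℤ, ((n + 1 : ℕ) : ℤ) + 2 < j → zcoeff F j = 0 := by
    intro j hj
    push_cast at hj
    rw [zF, zcoeff_P_of_gt α t k (by omega), zcoeff_P_of_gt α t k (by omega),
      zcoeff_P_of_gt α t k (by omega)]
    ring
  have hGd : ∀ j : ℤ, (n : ℤ) + 2 < j → zcoeff G j = 0 := by
    intro j hj
    rw [zG, zcoeff_P_of_gt α t k (by omega), zcoeff_P_of_gt α t k (by omega)]
    ring
  rw [e, map_sub, map_add, hp, moment_C_mul, moment_P_mul hα ht (n + 1) F hFd,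
    moment_P_mul hα ht n G hGd, form_P_succ hα ht, zF, zF, zG, zG]
  have s1 : ((n + 1 : ℕ) : ℤ) - 1 = n := by push_cast; ring
  have s2 : ((n + 1 : ℕ) : ℤ) - 3 = n - 2 := by push_cast; ring
  have s3 : ((n + 1 : ℕ) : ℤ) + 1 = n + 2 := by push_cast; ring
  have s4 : ((n + 1 : ℕ) : ℤ) + 2 - 1 = n + 2 := by push_cast; ring
  have s5 : ((n + 1 : ℕ) : ℤ) + 2 - 3 = n := by push_cast; ring
  have s6 : ((n + 1 : ℕ) : ℤ) + 2 + 1 = n + 4 := by push_cast; ring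
  have s7 : (n : ℤ) + 2 - 2 = n := by ring
  rw [s1, s2, s3, s4, s5, s6, s7, zcoeff_P_of_gt α t k (by omega : (k : ℤ) < n + 2),
    zcoeff_P_of_gt α t k (by omega : (k : ℤ) < n + 4)]
  obtain h | h | h | h : n = k ∨ n = k + 1 ∨ n = k + 2 ∨ k + 2 < n := by omega
  -- The case k = n forces the value of `ladderA`. For k = n - 1 parity suffices, for k = n - 2 the
  -- leading terms cancel, and for smaller k the degrees are too low.
  · subst h
    rw [zcoeff_P_self, zcoeff_P_sub_two]
    simp only [ladderA, ladderB, beta]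
    push_cast
    ring
  · rw [zcoeff_P_of_gt α t k (by omega : (k : ℤ) < n),
      zcoeff_P_of_odd hα ht k (j := (n : ℤ) - 2) ⟨0, by rw [h]; push_cast; ring⟩]
    ring
  · have h' : (n : ℤ) - 2 = k := by omega
    rw [zcoeff_P_of_gt α t k (by omega : (k : ℤ) < n), h', zcoeff_P_self, h]
    push_cast
    ring
  · rw [zcoeff_P_of_gt α t k (by omega : (k : ℤ) < n),
      zcoeff_P_of_gt α t k (by omega : (k : ℤ) < n - 2)]
    ring

/-- The lowering relation for `P`. -/
theorem lowering {α t : ℝ} (hα : 0 < α) (ht : 0 < t) (n : ℕ) :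
    loweringDefect α t n = 0 :=
  eq_zero_of_moment_P_mul hα ht _ (n + 1) (degree_loweringDefect_lt hα ht n)
    fun k hk => moment_P_mul_loweringDefect hα ht n k (Nat.lt_succ_iff.1 hk)

/-! ### The compatibility conditions -/

theorem ladderB_zero (α t : ℝ) : ladderB α t 0 = 0 := by
  simp [ladderB, beta, subleadingCoeff_zero, subleadingCoeff_one]

/-- The raising relation for `P`. -/
theorem raising {α t : ℝ} (hα : 0 < α) (ht : 0 < t) (n : ℕ) :
    (1 - X ^ 2) ^ 2 * derivative (P α t n) =
      (C (ladderB α t (n + 1) + 2 * α + 2 * t) * X - C ((n : ℝ) + 1 + 2 * α) * X ^ 3) * P α t n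
        - (C (ladderA α t n) - C (2 * n + 1 + 2 * α) * X ^ 2) * P α t (n + 1) := by
  cases n with
  | zero =>
    rw [P_zero, zero_add, P_one hα ht, ladderA, ladderB_zero]
    simp
    ring
  | succ m =>
    have h := lowering hα ht m
    rw [loweringDefect] at h
    -- The recurrence trades β_n P_{n-1} for x P_n - P_{n+1} in the lowering relation.
    rw [P_add_two hα ht m]
    simp only [ladderA, map_add, map_mul, map_natCast, map_ofNat, map_one, Nat.cast_add,
      Nat.cast_one] at h ⊢
    linear_combination h

/-- Differentiate the recurrence and insert the ladder relations for P_{n+2}', P_{n+1}' and P_n'.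
Everything reduces to a constant times P_{n+1}, so the constant is zero. -/
theorem beta_mul_ladderA {α t : ℝ} (hα : 0 < α) (ht : 0 < t) (n : ℕ) :
    beta α t (n + 2) * ladderA α t (n + 2) = 1 + beta α t (n + 1) * ladderA α t n := by
  have h0 := raising hα ht n
  have h1 := lowering hα ht n
  have h2 := lowering hα ht (n + 1)
  have hrec := P_add_two hα ht n
  have hd := congrArg derivative hrec
  simp only [derivative_sub, derivative_mul, derivative_X, derivative_C] at hd
  -- This linear relation cancels the X² P_{n+1} terms.
  have hb : C (ladderB α t (n + 2)) = C (ladderB α t (n + 1) + 2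
      + (2 * n + 1 + 2 * α) * beta α t (n + 1) - (2 * n + 5 + 2 * α) * beta α t (n + 2)) := by
    congr 1
    simp only [ladderB, beta]
    push_cast
    ring
  rw [loweringDefect] at h1 h2
  have key : P α t (n + 1) * C (beta α t (n + 2) * ladderA α t (n + 2)
      - 1 - beta α t (n + 1) * ladderA α t n) = 0 := by
    have hA : ladderA α t (n + 1) =
        ladderB α t (n + 2) + ladderB α t (n + 1) + 2 * α + 2 * t := rfl
    rw [hA] at h1
    simp only [map_add, map_sub, map_mul, map_natCast, map_ofNat, map_one, Nat.cast_add,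
      Nat.cast_one] at h0 h1 h2 hb ⊢
    linear_combination -h2 + (1 - X ^ 2) ^ 2 * hd
      + (C (ladderB α t (n + 2)) * X - ((n : ℝ[X]) + 1 + 1) * X ^ 3) * hrec + X * h1
      - C (beta α t (n + 1)) * h0 + X ^ 2 * P α t (n + 1) * hb
  have := (mul_eq_zero.1 key).resolve_left (P_monic α t (n + 1)).ne_zero
  rw [C_eq_zero] at this
  linarith

theorem beta_one_mul_ladderA {α t : ℝ} (hα : 0 < α) (ht : 0 < t) :
    beta α t 1 * ladderA α t 1 = 1 := by
  have h := lowering hα ht 0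
  rw [loweringDefect, zero_add, P_one hα ht, P_zero] at h
  have := congrArg (eval 0) h
  simp at this
  linarith

/-! ### The difference equation -/

/-- The sum of the constant terms of the ladder coefficients `A j`, `j < n`. -/
def sumA (α t : ℝ) (n : ℕ) : ℝ :=
  ∑ j ∈ Finset.range n, ladderA α t j

theorem sumA_succ (α t : ℝ) (n : ℕ) : sumA α t (n + 1) = sumA α t n + ladderA α t n :=
  Finset.sum_range_succ _ _

theorem sumA_eq_beta_mul {α t : ℝ} (hα : 0 < α) (ht : 0 < t) (n : ℕ) :
    sumA α t (n + 1) = beta α t (n + 1) * ladderA α t (n + 1) * ladderA α t n := by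
  induction n with
  | zero => simp [sumA, beta_one_mul_ladderA hα ht]
  | succ n ih =>
    rw [sumA_succ, ih]
    -- Multiplied by A_{n+1}, the compatibility condition telescopes.
    linear_combination (-ladderA α t (n + 1)) * beta_mul_ladderA hα ht n

theorem sumA_eq_linear (α t : ℝ) (n : ℕ) :
    sumA α t n = 2 * (n + α) * ladderB α t n + n * (2 * α + 2 * t) - 2 * (n ^ 2 + 2 * α * n)
      + (2 * n + 1 + 2 * α) * (2 * n - 1 + 2 * α) * beta α t n := by
  induction n with
  | zero => simp [sumA, ladderB_zero, beta, subleadingCoeff_zero, subleadingCoeff_one]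
  | succ n ih =>
    rw [sumA_succ, ih]
    simp only [ladderA, ladderB, beta]
    push_cast
    ring

theorem ladderB_sq {α t : ℝ} (hα : 0 < α) (ht : 0 < t) (n : ℕ) :
    ladderB α t (n + 1) ^ 2 + (2 * α + 2 * t) * ladderB α t (n + 1)
        - ((n + 1) ^ 2 + 2 * α * (n + 1)) - 2 * sumA α t (n + 1)
      = -(beta α t (n + 1) * ((2 * n + 3 + 2 * α) * ladderA α t n
          + (2 * n + 1 + 2 * α) * ladderA α t (n + 1))) := by
  induction n with
  | zero =>
    have h := beta_one_mul_ladderA hα ht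
    have h2 : ladderA α t 0 = ladderB α t 1 + 2 * α + 2 * t := by simp [ladderA, ladderB_zero]
    have h3 : ladderB α t 1 = 2 - (3 + 2 * α) * beta α t 1 := by
      rw [ladderB, subleadingCoeff_one]
      push_cast
      ring
    simp only [zero_add, sumA, Finset.sum_range_one, Nat.cast_zero]
    rw [h2]
    linear_combination (1 + 2 * α) * h + (ladderB α t 1 + 2 * α + 2 * t) * h3
  | succ n ih =>
    have h := beta_mul_ladderA hα ht n
    have hb : ladderB α t (n + 2) = ladderB α t (n + 1) + 2
        + (2 * n + 1 + 2 * α) * beta α t (n + 1)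
        - (2 * n + 5 + 2 * α) * beta α t (n + 2) := by
      simp only [ladderB, beta]
      push_cast
      ring
    have hA : ladderA α t (n + 1) =
        ladderB α t (n + 2) + ladderB α t (n + 1) + 2 * α + 2 * t := rfl
    rw [sumA_succ]
    push_cast
    -- The increment of B² + (2α + 2t) B factors as (B_{n+2} - B_{n+1}) A_{n+1}, so the linear
    -- relation `hb` applies.
    linear_combination ih + (2 * n + 3 + 2 * α) * h + ladderA α t (n + 1) * hb
      - (ladderB α t (n + 2) - ladderB α t (n + 1)) * hA

end PollaczekJacobi

end

/-- The second-order nonlinear difference equation for `p(n) = p(n,t)`; `pm` and `pp` stand for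
`p̃(n-1)` and `p̃(n+1)`. -/
theorem mainTheorem2 (α t : ℝ) (hα : 0 < α) (ht : 0 < t) (n : ℕ) (hn : 1 ≤ n) :
    let p : ℕ → ℝ := PollaczekJacobi.subleadingCoeff α t
    let pm : ℝ := (2 * n - 3 + 2 * α) * (p (n - 1) - p n)
    let pp : ℝ := (2 * n + 1 + 2 * α) * (p n - p (n + 1))
    (n + 2 * p n - pp) ^ 3
      + (n + 2 * p n - pp) ^ 2 * (n - 2 + 4 * t - pm + pp)
      - 2 * (n + 2 * p n - pp) *
          ((n : ℝ) ^ 2 - n * (1 - α) - α + 2 * t - 2 * t ^ 2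
            - pm * (n + α - t - pp) - (n - 1 + 2 * t) * pp)
      - (n - 1 + 2 * t - pm) * (2 * n * t - pp * (n - 1 + 2 * t - pm))
      + 4 * p n ^ 2 * pp
      + 2 * p n *
          ((n + 2 * p n - pp) ^ 2
            + 2 * pp * (n - 1 + 2 * t - pm)
            - 2 * (n + 2 * p n - pp) * (n + α - t - pp)
            - 2 * n * t)
      = 0 := by

  obtain ⟨m, rfl⟩ : ∃ m, n = m + 1 := ⟨n - 1, by omega⟩
  intro p pm pp
  have hS := PollaczekJacobi.sumA_eq_beta_mul hα ht m
  have hL := PollaczekJacobi.sumA_eq_linear α t (m + 1)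
  have hQ := PollaczekJacobi.ladderB_sq hα ht m
  have hr : PollaczekJacobi.ladderB α t (m + 1) = 2 * (m + 1) + 2 * p (m + 1) - pp := by
    simp only [PollaczekJacobi.ladderB, PollaczekJacobi.beta, pp, p]
    push_cast
    ring
  -- The weight 2n - 3 + 2α in `pm` is two less than the one in B_{n-1}; the difference replaces
  -- p(n-1) by p(n).
  have hr' : PollaczekJacobi.ladderB α t m = 2 * m + 2 * p (m + 1) - pm := by
    simp only [PollaczekJacobi.ladderB, PollaczekJacobi.beta, pm, p, Nat.add_sub_cancel]
    push_cast
    ring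
  have hA : PollaczekJacobi.ladderA α t m = PollaczekJacobi.ladderB α t (m + 1)
      + PollaczekJacobi.ladderB α t m + 2 * α + 2 * t := rfl
  have hβ : (2 * m + 3 + 2 * α) * PollaczekJacobi.beta α t (m + 1) = pp := by
    simp only [PollaczekJacobi.beta, pp, p]
    push_cast
    ring
  rw [hr, hr'] at hA
  rw [hr] at hL hQ
  push_cast at hL ⊢
  generalize PollaczekJacobi.sumA α t (m + 1) = S at *
  generalize PollaczekJacobi.ladderA α t (m + 1) = A₁ at *
  generalize PollaczekJacobi.beta α t (m + 1) = b at *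
  generalize PollaczekJacobi.ladderA α t m = A₀ at *
  generalize p (m + 1) = q at *
  clear_value pm pp
  subst hA
  have hL' : S = 2 * (m + 1 + α) * (2 * (m + 1) + 2 * q - pp) + (m + 1) * (2 * α + 2 * t)
      - 2 * ((m + 1) ^ 2 + 2 * α * (m + 1)) + (2 * m + 1 + 2 * α) * pp := by
    linear_combination hL + (2 * m + 1 + 2 * α) * hβ
  -- Multiplying `hQ` by A_{n-1} turns its β_n A_n term into the product β_n A_n A_{n-1}, which is S
  -- by `hS`; A_n is thereby eliminated.
  have hE : (2 * m + 1 + 2 * α) * S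
      + (2 * (m + 1) + 2 * q - pp + (2 * m + 2 * q - pm) + 2 * α + 2 * t)
        * ((2 * (m + 1) + 2 * q - pp) ^ 2 + (2 * α + 2 * t) * (2 * (m + 1) + 2 * q - pp)
          - ((m + 1) ^ 2 + 2 * α * (m + 1)) - 2 * S
          + pp * (2 * (m + 1) + 2 * q - pp + (2 * m + 2 * q - pm) + 2 * α + 2 * t)) = 0 := by
    rw [← hβ] at *
    linear_combination (2 * m + 1 + 2 * α) * hS + (2 * (m + 1) + 2 * q - (2 * m + 3 + 2 * α) * b
      + (2 * m + 2 * q - pm) + 2 * α + 2 * t) * hQ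
  rw [hL'] at hE
  linear_combination hE
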